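/- Let $G$ be a finite, connected, regular simple graph with vertex set $V$, $|V|\ge 2$. Let $X$ be the lazy simple random walk on $G$, with transition matrix $P(x,x)=\tfrac12$, $P(x,y)=\tfrac{1}{2\deg(x)}$ if $\{x,y\}\in E(G)$, and $P(x,y)=0$ otherwise. Let $\tau_{\mathrm{cov}}$ be the first time $t\ge 0$ such that $\{X_0,\dots,X_t\}=V$, and let $t_{\mathrm{cov}}(G)=\max_{x\in V}\mathbf E_x[\tau_{\mathrm{cov}}]$. The lamplighter walk on $\mathbf Z_2\wr G$ is the Markov chain on the pairs $(f,x)$, $f\colon V\to\{0,1\}$, $x\in V$, which moves from $(f,x)$ by choosing $y$ according to $P(x,\cdot)$, moving to $y$, and resetting the values $f_x$ and $f_y$ to independent uniform values in $\{0,1\}$ (one uniform value if $y=x$), all other values of $f$ being kept. Let $P^\diamond$ be its transition matrix, let $\pi^\diamond(f,x)=2^{-|V|}\deg(x)/\sum_{v}\deg(v)$, and let $$t_{\mathrm{mix}}(\mathbf Z_2\wr G)=\min\Big\{t\ge 0:\ \max_{(f,x)}\big\|(P^\diamond)^t((f,x),\cdot)-\pi^\diamond\big\|_{\mathrm{TV}}\le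 \tfrac14\Big\},\qquad \|\mu-\nu\|_{\mathrm{TV}}=\max_A|\mu(A)-\nu(A)| .$$ Then $\pi^\diamond$ is a stationary distribution of the lamplighter walk, $t_{\mathrm{cov}}(G)<\infty$, and $t_{\mathrm{mix}}(\mathbf Z_2\wr G)$ is comparable to $t_{\mathrm{cov}}(G)$ up to universal constants, namely $$c_2\, t_{\mathrm{cov}}(G)\ \le\ t_{\mathrm{mix}}(\mathbf Z_2\wr G)\ \le\ C_2\, t_{\mathrm{cov}}(G)\qquad\text{with } c_2=\tfrac1{12},\ C_2=18 .$$ -/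

import Mathlib

open scoped ENNReal

noncomputable section

namespace Lamplighter

section General

variable {S : Type*} [Fintype S] [DecidableEq S]

/-- Total variation distance `max_A |μ(A) - ν(A)|` of two mass functions on a finite set. -/
def tvDist (μ ν : S → ℝ) : ℝ :=
  ⨆ A : Finset S, |∑ a ∈ A, μ a - ∑ a ∈ A, ν a|

/-- `π` is a stationary distribution of the transition matrix `P`: a probability vector with
`π P = π`. -/
def IsStationary (P : Matrix S S ℝ) (π : S → ℝ) : Prop :=
  (∀ x, 0 ≤ π x) ∧ ∑ x, π x = 1 ∧ Matrix.vecMul π P = π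

/-- `d(t) = max_x ‖P^t(x, ·) - π‖_TV`. -/
def mixDist (P : Matrix S S ℝ) (π : S → ℝ) (t : ℕ) : ℝ :=
  ⨆ x : S, tvDist ((P ^ t) x) π

/-- The `ε`-mixing time `min {t ≥ 0 : d(t) ≤ ε}`, equal to `⊤` if there is no such `t`. -/
def mixingTime (P : Matrix S S ℝ) (π : S → ℝ) (ε : ℝ) : ℕ∞ :=
  ⨅ (t : ℕ) (_ : mixDist P π t ≤ ε), (t : ℕ∞)

/-- One step of the chain from `x`: the probability measure with mass `P x y` at `y`. -/
def stepMeasure [MeasurableSpace S] (P : Matrix S S ℝ) (x : S) : MeasureTheory.Measure S :=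
  ∑ y, ENNReal.ofReal (P x y) • MeasureTheory.Measure.dirac y

lemma isProbabilityMeasure_stepMeasure [MeasurableSpace S] {P : Matrix S S ℝ}
    (hP : P ∈ Matrix.rowStochastic ℝ S) (x : S) :
    MeasureTheory.IsProbabilityMeasure (stepMeasure P x) := by
  constructor
  rw [stepMeasure, MeasureTheory.Measure.coe_finsetSum, Finset.sum_apply]
  simp only [MeasureTheory.Measure.smul_apply, MeasureTheory.measure_univ, smul_eq_mul, mul_one]
  rw [← ENNReal.ofReal_sum_of_nonneg (fun y _ => hP.1 x y),
    Matrix.sum_row_of_mem_rowStochastic hP, ENNReal.ofReal_one]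

/-- The transition matrix as a kernel from the history `(X_0, …, X_n)` to `X_{n+1}`; it depends on
`X_n` only. -/
def stepKernel [MeasurableSpace S] [DiscreteMeasurableSpace S] (P : Matrix S S ℝ) (n : ℕ) :
    ProbabilityTheory.Kernel (Finset.Iic n → S) S where
  toFun h := stepMeasure P (h ⟨n, Finset.mem_Iic.2 le_rfl⟩)
  measurable' := (Measurable.of_discrete (f := stepMeasure P)).comp (measurable_pi_apply _)

/-- The law `P_x` on trajectories `ℕ → S` of the Markov chain with transition matrix `P` started
at `x`. -/
def pathLaw [MeasurableSpace S] [DiscreteMeasurableSpace S] (P : Matrix S S ℝ)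
    (hP : P ∈ Matrix.rowStochastic ℝ S) (x : S) : MeasureTheory.Measure (ℕ → S) :=
  haveI : ∀ n, ProbabilityTheory.IsMarkovKernel (stepKernel P n) :=
    fun _ => ⟨fun _ => isProbabilityMeasure_stepMeasure hP _⟩
  ProbabilityTheory.Kernel.traj (X := fun _ : ℕ => S) (fun n => stepKernel P n) 0 (fun _ => x)

/-- The first time by which a trajectory has visited every state (`⊤` if there is none). -/
def coverStep (ω : ℕ → S) : ℕ∞ :=
  ⨅ (t : ℕ) (_ : ∀ v : S, ∃ s ≤ t, ω s = v), (t : ℕ∞)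

/-- The cover time `max_x E_x[τ_cov]`. -/
def coverTime (P : Matrix S S ℝ) (hP : P ∈ Matrix.rowStochastic ℝ S) : ℝ≥0∞ :=
  letI : MeasurableSpace S := ⊤
  haveI : DiscreteMeasurableSpace S := ⟨fun _ => trivial⟩
  ⨆ x : S, ∫⁻ ω, (coverStep ω : ℝ≥0∞) ∂(pathLaw P hP x)

/-- The lamplighter walk over the base chain `P`, on pairs (lamp configuration, position): from
`(f, x)` choose `y` according to `P x`, then set the lamps at `x` and at `y` to independent
uniform values `a` and `b`. -/
def lampMatrix (P : Matrix S S ℝ) : Matrix ((S → ZMod 2) × S) ((S → ZMod 2) × S) ℝ :=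
  fun p q => P p.2 q.2 * ∑ a : ZMod 2, ∑ b : ZMod 2,
    if q.1 = Function.update (Function.update p.1 p.2 a) q.2 b then 1 / 4 else 0

/-- The product of the uniform law on lamp configurations with the law `π` on positions. -/
def lampDist (π : S → ℝ) : (S → ZMod 2) × S → ℝ :=
  fun p => π p.2 * (2 ^ Fintype.card S)⁻¹

end General

section Graph

variable {V : Type*} [Fintype V] [DecidableEq V] (G : SimpleGraph V) [DecidableRel G.Adj]

/-- Transition matrix of the lazy simple random walk on `G`. -/
def lazyWalk : Matrix V V ℝ :=
  fun x y => if x = y then 1 / 2 else if G.Adj x y then 1 / (2 * (G.degree x : ℝ)) else 0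

lemma lazyWalk_mem [Nontrivial V] {G : SimpleGraph V} [DecidableRel G.Adj] (hG : G.Connected) :
    lazyWalk G ∈ Matrix.rowStochastic ℝ V := by
  rw [Matrix.mem_rowStochastic_iff_sum]
  refine ⟨fun x y => ?_, fun x => ?_⟩
  · unfold lazyWalk
    split_ifs <;> positivity
  · have hd : (G.degree x : ℝ) ≠ 0 := by
      exact_mod_cast (hG.preconnected.degree_pos_of_nontrivial x).ne'
    have h : ∀ y, lazyWalk G x y =
        (if x = y then 1 / 2 else 0) + if G.Adj x y then 1 / (2 * (G.degree x : ℝ)) else 0 := by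
      intro y
      unfold lazyWalk
      by_cases hxy : x = y
      · subst hxy
        simp
      · simp [hxy]
    simp only [h, Finset.sum_add_distrib, Finset.sum_ite_eq, Finset.mem_univ, if_true]
    rw [← Finset.sum_filter, ← SimpleGraph.neighborFinset_eq_filter, Finset.sum_const,
      SimpleGraph.card_neighborFinset_eq_degree, nsmul_eq_mul]
    field_simp
    norm_num

/-- The stationary distribution `x ↦ deg x / ∑ deg` of the lazy walk. -/
def degreeDist : V → ℝ :=
  fun x => (G.degree x : ℝ) / ∑ v, (G.degree v : ℝ)

end Graph

end Lamplighter

end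

/-!
Given the trajectory of the base chain, the lamps at the visited states are independent and
uniform, and the other ones are untouched. So at time `t ≥ 1` the lamplighter walk started over `x`
is within `P_x(τ_cov > t) + ∑ y, |π y - (P ^ t) x y|` of equilibrium. The first term is at most
`t_cov / (t + 1)` by Markov's inequality. For the second one, the argument behind Kac's formula
shows that the first `T` return probabilities `(P ^ s) x x` add up to `π x * (T + E_x[h(X_T)])`,
where `h ≤ t_cov` is the expected hitting time of `x`. For a reversible lazy chain these
probabilities are nonincreasing in `s`, so `(P ^ (2 * t)) x x / π x - 1 ≤ t_cov / (2 * t)`, and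
by reversibility and the Cauchy–Schwarz inequality the left-hand side dominates the square of the
second term.

Conversely, the walk cannot switch all lamps from `0` to `1` before the base chain has covered the
state space. If the lamplighter walk is `1 / 4`-mixed at time `t`, reversibility
bounds all its transition probabilities at time `2 * t` from below by a quarter of the stationary
ones, so the base chain covers within `2 * t` steps with probability at least `1 / 4` from
every starting point, and `t_cov ≤ 8 * t` by restarting it.
-/

noncomputable section

namespace Lamplighter

open Matrix

section Stationarity

variable {S : Type*} {P : Matrix S S ℝ} {π : S → ℝ}

/-- `π` is a reversible distribution of the transition matrix `P`: a probability vector satisfying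
the detailed balance equations. -/
structure IsReversible [Fintype S] (P : Matrix S S ℝ) (π : S → ℝ) : Prop where
  nonneg (x : S) : 0 ≤ π x
  sum_eq_one : ∑ x, π x = 1
  balance (x y : S) : π x * P x y = π y * P y x

variable [Fintype S]

lemma IsStationary.sum_mul_mulVec (hπ : IsStationary P π) (v : S → ℝ) :
    ∑ x, π x * (P *ᵥ v) x = ∑ x, π x * v x := by
  have h : π ⬝ᵥ P *ᵥ v = π ⬝ᵥ v := by rw [dotProduct_mulVec, hπ.2.2]
  exact h

variable [DecidableEq S]

lemma mulVec_le_mulVec_of_forall_le (hP : P ∈ rowStochastic ℝ S) {v w : S → ℝ}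
    (hvw : ∀ x, v x ≤ w x) (x : S) : (P *ᵥ v) x ≤ (P *ᵥ w) x :=
  Finset.sum_le_sum fun y _ => mul_le_mul_of_nonneg_left (hvw y) (hP.1 x y)

lemma mulVec_le_of_forall_le (hP : P ∈ rowStochastic ℝ S) {v : S → ℝ} {C : ℝ}
    (hv : ∀ x, v x ≤ C) (x : S) : (P *ᵥ v) x ≤ C :=
  calc (P *ᵥ v) x ≤ ∑ y, P x y * C :=
        mulVec_le_mulVec_of_forall_le hP hv x
    _ = C := by rw [← Finset.sum_mul, sum_row_of_mem_rowStochastic hP, one_mul]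

lemma IsReversible.isStationary (hP : P ∈ rowStochastic ℝ S) (hrev : IsReversible P π) :
    IsStationary P π := by
  refine ⟨hrev.nonneg, hrev.sum_eq_one, funext fun y => ?_⟩
  calc ∑ x, π x * P x y = ∑ x, π y * P y x := Finset.sum_congr rfl fun x _ => hrev.balance x y
    _ = π y := by rw [← Finset.mul_sum, sum_row_of_mem_rowStochastic hP, mul_one]

lemma IsReversible.pow (hrev : IsReversible P π) (t : ℕ) : IsReversible (P ^ t) π := by
  refine ⟨hrev.nonneg, hrev.sum_eq_one, fun x y => ?_⟩
  induction t generalizing x y with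
  | zero =>
    obtain rfl | hxy := eq_or_ne x y
    · rfl
    · simp [one_apply_ne hxy, one_apply_ne hxy.symm]
  | succ t ih =>
    calc π x * (P ^ (t + 1)) x y = ∑ z, π x * (P ^ t) x z * P z y := by
          simp only [pow_succ, mul_apply, Finset.mul_sum, mul_assoc]
      _ = ∑ z, π y * P y z * (P ^ t) z x := by
          refine Finset.sum_congr rfl fun z _ => ?_
          rw [ih, mul_right_comm, hrev.balance z y]
      _ = π y * (P ^ (t + 1)) y x := by
          simp only [pow_succ', mul_apply, Finset.mul_sum, mul_assoc]

lemma IsStationary.pow (hπ : IsStationary P π) (t : ℕ) : IsStationary (P ^ t) π := by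
  refine ⟨hπ.1, hπ.2.1, ?_⟩
  induction t with
  | zero => rw [pow_zero, vecMul_one]
  | succ t ih => rw [pow_succ, ← vecMul_vecMul, ih, hπ.2.2]

omit [DecidableEq S] in
lemma IsStationary.pos_of_isIrreducible (hπ : IsStationary P π) (hirr : P.IsIrreducible) (y : S) :
    0 < π y := by
  classical
  obtain ⟨x, -, hx⟩ : ∃ x ∈ Finset.univ, 0 < π x :=
    Finset.exists_lt_of_sum_lt (by simp [hπ.2.1])
  obtain ⟨t, -, ht⟩ := (isIrreducible_iff_exists_pow_pos hirr.nonneg).1 hirr x y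
  calc 0 < π x * (P ^ t) x y := mul_pos hx ht
    _ ≤ ∑ z, π z * (P ^ t) z y := Finset.single_le_sum
        (f := fun z => π z * (P ^ t) z y)
        (fun z _ => mul_nonneg (hπ.1 z) (pow_apply_nonneg hirr.nonneg t z y)) (Finset.mem_univ x)
    _ = π y := congrFun (hπ.pow t).2.2 y

end Stationarity

section LazyChains

variable {S : Type*} [Fintype S] [DecidableEq S] {P : Matrix S S ℝ} {π : S → ℝ}

lemma IsStationary.sum_mul_mulVec_sq_le (hP : P ∈ rowStochastic ℝ S) (hπ : IsStationary P π)
    (v : S → ℝ) : ∑ x, π x * (P *ᵥ v) x ^ 2 ≤ ∑ x, π x * v x ^ 2 := by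
  calc ∑ x, π x * (P *ᵥ v) x ^ 2 ≤ ∑ x, π x * (P *ᵥ fun y => v y ^ 2) x :=
        Finset.sum_le_sum fun x _ => mul_le_mul_of_nonneg_left
          (Real.pow_arith_mean_le_arith_mean_pow_of_even Finset.univ _ v (fun y _ => hP.1 x y)
            (sum_row_of_mem_rowStochastic hP x) even_two) (hπ.1 x)
    _ = ∑ x, π x * v x ^ 2 := hπ.sum_mul_mulVec _

lemma two_smul_sub_one_mem_rowStochastic (hP : P ∈ rowStochastic ℝ S)
    (hlazy : ∀ x, 1 / 2 ≤ P x x) : (2 : ℝ) • P - 1 ∈ rowStochastic ℝ S := by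
  refine ⟨fun x y => ?_, ?_⟩
  · rw [Matrix.sub_apply, Matrix.smul_apply, smul_eq_mul]
    obtain rfl | hxy := eq_or_ne x y
    · rw [one_apply_eq]
      linarith [hlazy x]
    · rw [one_apply_ne hxy]
      linarith [hP.1 x y]
  · rw [sub_mulVec, smul_mulVec, one_mulVec, hP.2, two_smul, add_sub_cancel_right]

/-- Apply the contraction property to the chain `2 P - 1`, of which `P` is the lazy version. -/
lemma IsStationary.sum_mul_mulVec_sq_le_of_lazy (hP : P ∈ rowStochastic ℝ S)
    (hπ : IsStationary P π) (hlazy : ∀ x, 1 / 2 ≤ P x x) (v : S → ℝ) :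
    ∑ x, π x * (P *ᵥ v) x ^ 2 ≤ ∑ x, π x * (v x * (P *ᵥ v) x) := by
  have hπ' : IsStationary ((2 : ℝ) • P - 1) π := by
    refine ⟨hπ.1, hπ.2.1, ?_⟩
    rw [vecMul_sub, vecMul_smul, vecMul_one, hπ.2.2, two_smul, add_sub_cancel_right]
  have hcontr := hπ'.sum_mul_mulVec_sq_le (two_smul_sub_one_mem_rowStochastic hP hlazy) v
  have hexpand : ∀ x, π x * (((2 : ℝ) • P - 1) *ᵥ v) x ^ 2 =
      4 * (π x * (P *ᵥ v) x ^ 2) - 4 * (π x * (v x * (P *ᵥ v) x)) + π x * v x ^ 2 := by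
    intro x
    rw [sub_mulVec, smul_mulVec, one_mulVec, Pi.sub_apply, Pi.smul_apply, smul_eq_mul]
    ring
  simp_rw [hexpand, Finset.sum_add_distrib, Finset.sum_sub_distrib, ← Finset.mul_sum] at hcontr
  linarith

lemma IsStationary.sum_mul_mul_mulVec_le (hP : P ∈ rowStochastic ℝ S) (hπ : IsStationary P π)
    (v : S → ℝ) : ∑ x, π x * (v x * (P *ᵥ v) x) ≤ ∑ x, π x * v x ^ 2 := by
  have hcontr := hπ.sum_mul_mulVec_sq_le hP v
  have hamgm : ∑ x, π x * (v x * (P *ᵥ v) x) ≤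
      ∑ x, (π x * v x ^ 2 / 2 + π x * (P *ᵥ v) x ^ 2 / 2) :=
    Finset.sum_le_sum fun x _ => by nlinarith [mul_nonneg (hπ.1 x) (sq_nonneg (v x - (P *ᵥ v) x))]
  rw [Finset.sum_add_distrib, ← Finset.sum_div, ← Finset.sum_div] at hamgm
  linarith

lemma IsReversible.mul_pow_add_apply_self (hrev : IsReversible P π) (s t : ℕ) (y : S) :
    π y * (P ^ (s + t)) y y = ∑ z, π z * ((P ^ s) z y * (P ^ t) z y) := by
  rw [pow_add, mul_apply, Finset.mul_sum]
  refine Finset.sum_congr rfl fun z _ => ?_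
  rw [← mul_assoc, (hrev.pow s).balance y z, mul_assoc]

lemma IsReversible.antitone_pow_apply_self (hP : P ∈ rowStochastic ℝ S) (hrev : IsReversible P π)
    (hlazy : ∀ x, 1 / 2 ≤ P x x) {y : S} (hy : 0 < π y) : Antitone fun t => (P ^ t) y y := by
  have hπ := hrev.isStationary hP
  refine antitone_nat_of_succ_le fun t => le_of_mul_le_mul_left ?_ hy
  have hcol : ∀ s z, (P *ᵥ fun w => (P ^ s) w y) z = (P ^ (s + 1)) z y := fun s z => by
    rw [pow_succ', mul_apply]
    rfl
  obtain ⟨s, rfl | rfl⟩ := Nat.even_or_odd' t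
  · have h := hπ.sum_mul_mul_mulVec_le hP fun w => (P ^ s) w y
    simp_rw [hcol, sq, ← hrev.mul_pow_add_apply_self] at h
    rwa [two_mul, add_assoc]
  · have h := hπ.sum_mul_mulVec_sq_le_of_lazy hP hlazy fun w => (P ^ s) w y
    simp_rw [hcol, sq, ← hrev.mul_pow_add_apply_self] at h
    rwa [show 2 * s + 1 = s + (s + 1) by ring, show s + (s + 1) + 1 = s + 1 + (s + 1) by ring]

lemma IsReversible.pow_apply_div (hrev : IsReversible P π) (hpos : ∀ x, 0 < π x) (t : ℕ)
    (x y : S) : (P ^ t) x y / π y = (P ^ t) y x / π x := by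
  rw [div_eq_div_iff (hpos y).ne' (hpos x).ne', mul_comm, (hrev.pow t).balance, mul_comm]

/-- Cauchy–Schwarz bounds the `L¹` distance to `π` by the `L²(π)` distance. -/
lemma IsReversible.sq_sum_abs_sub_pow_le (hP : P ∈ rowStochastic ℝ S) (hrev : IsReversible P π)
    (hpos : ∀ x, 0 < π x) (t : ℕ) (x : S) :
    (∑ y, |π y - (P ^ t) x y|) ^ 2 ≤ (P ^ (t + t)) x x / π x - 1 := by
  have hterm : ∀ y, |π y - (P ^ t) x y| ^ 2 / π y =
      π y - 2 * (P ^ t) x y + (P ^ t) x y * (P ^ t) y x / π x := by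
    intro y
    rw [sq_abs, mul_div_assoc, ← hrev.pow_apply_div hpos]
    field_simp [(hpos y).ne']
    ring
  calc (∑ y, |π y - (P ^ t) x y|) ^ 2
      = (∑ y, |π y - (P ^ t) x y|) ^ 2 / ∑ y, π y := by rw [hrev.sum_eq_one, div_one]
    _ ≤ ∑ y, |π y - (P ^ t) x y| ^ 2 / π y :=
        Finset.sq_sum_div_le_sum_sq_div _ _ fun y _ => hpos y
    _ = (P ^ (t + t)) x x / π x - 1 := by
        simp_rw [hterm, Finset.sum_add_distrib, Finset.sum_sub_distrib, ← Finset.mul_sum,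
          ← Finset.sum_div, ← mul_apply, ← pow_add, hrev.sum_eq_one,
          sum_row_of_mem_rowStochastic (pow_mem hP t)]
        ring

/-- Cauchy–Schwarz for `P ^ (2 t) x y = π y * ∑ z, P ^ t x z * P ^ t y z / π z`. -/
lemma IsReversible.mul_sq_sum_min_le (hP : P ∈ rowStochastic ℝ S) (hrev : IsReversible P π)
    (hpos : ∀ x, 0 < π x) (t : ℕ) (x y : S) :
    π y * (∑ z, min ((P ^ t) x z) ((P ^ t) y z)) ^ 2 ≤ (P ^ (t + t)) x y := by
  have hnonneg : ∀ a b, 0 ≤ (P ^ t) a b := (pow_mem hP t).1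
  calc π y * (∑ z, min ((P ^ t) x z) ((P ^ t) y z)) ^ 2
      = π y * ((∑ z, min ((P ^ t) x z) ((P ^ t) y z)) ^ 2 / ∑ z, π z) := by
        rw [hrev.sum_eq_one, div_one]
    _ ≤ π y * ∑ z, min ((P ^ t) x z) ((P ^ t) y z) ^ 2 / π z :=
        mul_le_mul_of_nonneg_left (Finset.sq_sum_div_le_sum_sq_div _ _ fun z _ => hpos z)
          (hpos y).le
    _ ≤ π y * ∑ z, (P ^ t) x z * (P ^ t) y z / π z := by
        refine mul_le_mul_of_nonneg_left (Finset.sum_le_sum fun z _ => ?_) (hpos y).le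
        rw [sq]
        exact div_le_div_of_nonneg_right (mul_le_mul (min_le_left _ _) (min_le_right _ _)
          (le_min (hnonneg x z) (hnonneg y z)) (hnonneg x z)) (hpos z).le
    _ = (P ^ (t + t)) x y := by
        rw [pow_add, mul_apply, Finset.mul_sum]
        refine Finset.sum_congr rfl fun z _ => ?_
        rw [mul_div_assoc, hrev.pow_apply_div hpos]
        field_simp [(hpos y).ne']

end LazyChains

open MeasureTheory ProbabilityTheory Preorder

section Visits

variable {S : Type*} [Fintype S] [DecidableEq S] {P : Matrix S S ℝ}

/-- Transition matrix of the chain of pairs (set of visited states, current state) of the chain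
`P`. -/
def visitMatrix (P : Matrix S S ℝ) : Matrix (Finset S × S) (Finset S × S) ℝ :=
  fun p q => if q.1 = insert q.2 p.1 then P p.2 q.2 else 0

lemma visitMatrix_mulVec (P : Matrix S S ℝ) (F : Finset S × S → ℝ) (p : Finset S × S) :
    (visitMatrix P *ᵥ F) p = ∑ y, P p.2 y * F (insert y p.1, y) := by
  change ∑ q, visitMatrix P p q * F q = _
  rw [Fintype.sum_prod_type_right]
  refine Finset.sum_congr rfl fun y _ => ?_
  simp [visitMatrix, ite_mul]

lemma visitMatrix_mem_rowStochastic (hP : P ∈ rowStochastic ℝ S) :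
    visitMatrix P ∈ rowStochastic ℝ (Finset S × S) := by
  refine ⟨fun p q => ?_, funext fun p => ?_⟩
  · unfold visitMatrix
    split_ifs
    exacts [hP.1 _ _, le_rfl]
  · simp [visitMatrix_mulVec, sum_row_of_mem_rowStochastic hP]

/-- The states visited by a trajectory up to time `t`. -/
def visited (ω : ℕ → S) (t : ℕ) : Finset S :=
  Finset.univ.image (frestrictLe (π := fun _ => S) t ω)

omit [Fintype S] in
lemma mem_visited {ω : ℕ → S} {t : ℕ} {v : S} : v ∈ visited ω t ↔ ∃ s ≤ t, ω s = v := by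
  simp [visited]

omit [Fintype S] in
lemma visited_zero (ω : ℕ → S) : visited ω 0 = {ω 0} := by
  ext v
  simp [mem_visited, eq_comm]

omit [Fintype S] in
lemma visited_succ (ω : ℕ → S) (t : ℕ) :
    visited ω (t + 1) = insert (ω (t + 1)) (visited ω t) := by
  ext v
  simp [mem_visited, Nat.le_succ_iff, or_and_right, exists_or, or_comm, eq_comm]

omit [DecidableEq S] in
lemma lintegral_stepMeasure [MeasurableSpace S] [DiscreteMeasurableSpace S] (P : Matrix S S ℝ)
    (x : S) (F : S → ℝ≥0∞) :
    ∫⁻ y, F y ∂stepMeasure P x = ∑ y, ENNReal.ofReal (P x y) * F y := by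
  simp [stepMeasure, lintegral_finsetSum_measure]

lemma lintegral_pathLaw_zero [MeasurableSpace S] [DiscreteMeasurableSpace S]
    (hP : P ∈ rowStochastic ℝ S) (x : S) (F : S → ℝ≥0∞) :
    ∫⁻ ω, F (ω 0) ∂pathLaw P hP x = F x := by
  have : ∀ n, IsMarkovKernel (stepKernel P n) :=
    fun _ => ⟨fun _ => isProbabilityMeasure_stepMeasure hP _⟩
  calc ∫⁻ ω, F (ω 0) ∂pathLaw P hP x
      = ∫⁻ h : Finset.Iic 0 → S, F (h ⟨0, Finset.mem_Iic.2 le_rfl⟩)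
          ∂(pathLaw P hP x).map (frestrictLe 0) := by
        rw [lintegral_map .of_discrete (measurable_frestrictLe 0)]
        rfl
    _ = F x := by
        rw [pathLaw, Kernel.traj_map_frestrictLe_apply, Kernel.partialTraj_self, Kernel.id_apply,
          lintegral_dirac]

lemma lintegral_pathLaw_succ [MeasurableSpace S] [DiscreteMeasurableSpace S]
    (hP : P ∈ rowStochastic ℝ S) (x : S) (t : ℕ) (F : (Finset.Iic t → S) → S → ℝ≥0∞) :
    ∫⁻ ω, F (frestrictLe t ω) (ω (t + 1)) ∂pathLaw P hP x =
      ∫⁻ ω, ∑ y, ENNReal.ofReal (P (ω t) y) * F (frestrictLe t ω) y ∂pathLaw P hP x := by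
  have : ∀ n, IsMarkovKernel (stepKernel P n) :=
    fun _ => ⟨fun _ => isProbabilityMeasure_stepMeasure hP _⟩
  calc ∫⁻ ω, F (frestrictLe t ω) (ω (t + 1)) ∂pathLaw P hP x
      = ∫⁻ p, F p.1 p.2 ∂(pathLaw P hP x).map fun ω => (frestrictLe t ω, ω (t + 1)) := by
        rw [lintegral_map .of_discrete (by fun_prop)]
    _ = ∫⁻ h, ∫⁻ y, F h y ∂stepKernel P t h ∂(pathLaw P hP x).map (frestrictLe t) := by
        rw [pathLaw, ← Kernel.partialTraj_compProd_eq_map_traj (Nat.zero_le t),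
          Measure.lintegral_compProd .of_discrete, Kernel.traj_map_frestrictLe_apply]
    _ = ∫⁻ ω, ∑ y, ENNReal.ofReal (P (ω t) y) * F (frestrictLe t ω) y ∂pathLaw P hP x := by
        rw [lintegral_map .of_discrete (measurable_frestrictLe t)]
        exact lintegral_congr fun ω => lintegral_stepMeasure P (ω t) _

lemma lintegral_pathLaw_visited [MeasurableSpace S] [DiscreteMeasurableSpace S]
    (hP : P ∈ rowStochastic ℝ S) (x : S) (t : ℕ) {F : Finset S × S → ℝ} (hF : ∀ p, 0 ≤ F p) :
    ∫⁻ ω, ENNReal.ofReal (F (visited ω t, ω t)) ∂pathLaw P hP x =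
      ENNReal.ofReal ((visitMatrix P ^ t *ᵥ F) ({x}, x)) := by
  induction t generalizing F with
  | zero =>
    simp_rw [visited_zero]
    rw [lintegral_pathLaw_zero hP x fun y => ENNReal.ofReal (F ({y}, y)), pow_zero, one_mulVec]
  | succ t ih =>
    calc ∫⁻ ω, ENNReal.ofReal (F (visited ω (t + 1), ω (t + 1))) ∂pathLaw P hP x
        = ∫⁻ ω, ∑ y, ENNReal.ofReal (P (ω t) y) *
            ENNReal.ofReal (F (insert y (visited ω t), y)) ∂pathLaw P hP x := by
          simp_rw [visited_succ]
          exact lintegral_pathLaw_succ hP x t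
            fun h y => ENNReal.ofReal (F (insert y (Finset.univ.image h), y))
      _ = ∫⁻ ω, ENNReal.ofReal ((visitMatrix P *ᵥ F) (visited ω t, ω t)) ∂pathLaw P hP x := by
          refine lintegral_congr fun ω => ?_
          rw [visitMatrix_mulVec, ENNReal.ofReal_sum_of_nonneg fun y _ =>
            mul_nonneg (hP.1 _ y) (hF _)]
          exact Finset.sum_congr rfl fun y _ => (ENNReal.ofReal_mul (hP.1 _ y)).symm
      _ = ENNReal.ofReal ((visitMatrix P ^ (t + 1) *ᵥ F) ({x}, x)) := by
          rw [ih (nonneg_mulVec_of_mem_rowStochastic (visitMatrix_mem_rowStochastic hP) hF),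
            mulVec_mulVec, ← pow_succ]

lemma toENNReal_iInf_eq_tsum {p : ℕ → Prop} [DecidablePred p] (hp : Monotone p) :
    ((⨅ (t : ℕ) (_ : p t), (t : ℕ∞) : ℕ∞) : ℝ≥0∞) = ∑' t, if p t then 0 else 1 := by
  by_cases h : ∃ t, p t
  · have hfind : (⨅ (t : ℕ) (_ : p t), (t : ℕ∞)) = Nat.find h :=
      le_antisymm (iInf₂_le _ (Nat.find_spec h))
        (le_iInf₂ fun t ht => Nat.cast_le.2 (Nat.find_min' h ht))
    rw [hfind, tsum_eq_sum (s := Finset.range (Nat.find h))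
      fun t ht => if_pos (hp (not_lt.1 (Finset.mem_range.not.1 ht)) (Nat.find_spec h)),
      Finset.sum_congr rfl fun t ht => if_neg (Nat.find_min h (Finset.mem_range.1 ht))]
    simp
  · push Not at h
    simp [h]

/-- The probability that some state is still unvisited at time `t`, for the chain of pairs (set of
visited states, current state) started at `p`. -/
def uncovered (P : Matrix S S ℝ) (t : ℕ) : Finset S × S → ℝ :=
  visitMatrix P ^ t *ᵥ fun q => if q.1 = Finset.univ then 0 else 1

lemma coverStep_eq_tsum (ω : ℕ → S) :
    (coverStep ω : ℝ≥0∞) = ∑' t, if visited ω t = Finset.univ then 0 else 1 := by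
  simp only [coverStep, Finset.eq_univ_iff_forall, mem_visited]
  exact toENNReal_iInf_eq_tsum fun s t hst hs v =>
    (hs v).imp fun r hr => ⟨hr.1.trans hst, hr.2⟩

lemma coverTime_eq_iSup_tsum (hP : P ∈ rowStochastic ℝ S) :
    coverTime P hP = ⨆ x, ∑' t, ENNReal.ofReal (uncovered P t ({x}, x)) := by
  let _ : MeasurableSpace S := ⊤
  have : DiscreteMeasurableSpace S := ⟨fun _ => trivial⟩
  refine iSup_congr fun x => ?_
  have hmeas : ∀ t, Measurable fun ω : ℕ → S =>
      (if visited ω t = Finset.univ then 0 else 1 : ℝ≥0∞) := fun t =>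
    (Measurable.of_discrete (f := fun h : Finset.Iic t → S =>
      (if Finset.univ.image h = Finset.univ then 0 else 1 : ℝ≥0∞))).comp (measurable_frestrictLe t)
  simp_rw [coverStep_eq_tsum]
  rw [lintegral_tsum fun t => (hmeas t).aemeasurable]
  refine tsum_congr fun t => ?_
  rw [uncovered, ← lintegral_pathLaw_visited hP x t fun q => by positivity]
  exact lintegral_congr fun ω => by split_ifs <;> simp

end Visits

section Covering

variable {S : Type*} [Fintype S] [DecidableEq S] {P : Matrix S S ℝ}

lemma uncovered_zero (p : Finset S × S) :
    uncovered P 0 p = if p.1 = Finset.univ then 0 else 1 := by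
  rw [uncovered, pow_zero, one_mulVec]

lemma uncovered_add (s t : ℕ) : uncovered P (s + t) = visitMatrix P ^ s *ᵥ uncovered P t := by
  rw [uncovered, uncovered, mulVec_mulVec, ← pow_add]

lemma uncovered_succ (t : ℕ) (p : Finset S × S) :
    uncovered P (t + 1) p = ∑ y, P p.2 y * uncovered P t (insert y p.1, y) := by
  rw [add_comm, uncovered_add, pow_one, visitMatrix_mulVec]

lemma uncovered_nonneg (hP : P ∈ rowStochastic ℝ S) (t : ℕ) (p : Finset S × S) :
    0 ≤ uncovered P t p :=
  nonneg_mulVec_of_mem_rowStochastic (pow_mem (visitMatrix_mem_rowStochastic hP) t)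
    (fun q => by positivity) p

lemma uncovered_anti_set (hP : P ∈ rowStochastic ℝ S) (t : ℕ) {A B : Finset S} (hAB : A ⊆ B)
    (x : S) : uncovered P t (B, x) ≤ uncovered P t (A, x) := by
  induction t generalizing x A B with
  | zero =>
    obtain rfl | hB := eq_or_ne B Finset.univ
    · exact (uncovered_zero _).trans_le (by simpa using uncovered_nonneg hP 0 (A, x))
    · have hA : A ≠ Finset.univ := by
        rintro rfl
        exact hB (Finset.univ_subset_iff.1 hAB)
      simp [uncovered_zero, hA, hB]
  | succ t ih =>
    rw [uncovered_succ, uncovered_succ]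
    exact Finset.sum_le_sum fun y _ =>
      mul_le_mul_of_nonneg_left (ih (Finset.insert_subset_insert y hAB) y) (hP.1 x y)

lemma uncovered_antitone (hP : P ∈ rowStochastic ℝ S) (p : Finset S × S) :
    Antitone fun t => uncovered P t p := by
  refine antitone_nat_of_succ_le fun t => ?_
  have hone : ∀ q, uncovered P 1 q ≤ uncovered P 0 q := by
    intro q
    rw [uncovered_succ]
    refine mulVec_le_of_forall_le hP (v := fun y => uncovered P 0 (insert y q.1, y)) (fun y => ?_)
      q.2
    refine (uncovered_anti_set hP 0 (Finset.subset_insert y q.1) y).trans_eq ?_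
    rw [uncovered_zero, uncovered_zero]
  rw [uncovered_add, ← add_zero t, uncovered_add]
  exact mulVec_le_mulVec_of_forall_le (pow_mem (visitMatrix_mem_rowStochastic hP) t) hone p

lemma uncovered_le_one (hP : P ∈ rowStochastic ℝ S) (t : ℕ) (p : Finset S × S) :
    uncovered P t p ≤ 1 := by
  refine (uncovered_antitone hP p t.zero_le).trans ?_
  simp only [uncovered_zero]
  split_ifs <;> norm_num

lemma uncovered_univ (hP : P ∈ rowStochastic ℝ S) (t : ℕ) (x : S) :
    uncovered P t (Finset.univ, x) = 0 :=
  le_antisymm ((uncovered_antitone hP _ t.zero_le).trans_eq (by simp [uncovered_zero]))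
    (uncovered_nonneg hP t _)

lemma insert_subset_of_visitMatrix_pow_ne_zero {t : ℕ} {p q : Finset S × S} (hp : p.2 ∈ p.1)
    (h : (visitMatrix P ^ t) p q ≠ 0) : insert q.2 p.1 ⊆ q.1 := by
  induction t generalizing q with
  | zero =>
    obtain rfl : p = q := by
      by_contra hpq
      exact h (by rw [pow_zero, one_apply_ne hpq])
    exact Finset.insert_subset hp le_rfl
  | succ t ih =>
    rw [pow_succ, mul_apply] at h
    obtain ⟨r, -, hr⟩ := Finset.exists_ne_zero_of_sum_ne_zero h
    have hq : q.1 = insert q.2 r.1 := by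
      by_contra hq
      exact right_ne_zero_of_mul hr (if_neg hq)
    rw [hq]
    exact Finset.insert_subset_insert _
      ((Finset.subset_insert _ _).trans (ih (left_ne_zero_of_mul hr)))

lemma sum_visitMatrix_pow (P : Matrix S S ℝ) (t : ℕ) (p : Finset S × S) (y : S) :
    ∑ B, (visitMatrix P ^ t) p (B, y) = (P ^ t) p.2 y := by
  induction t generalizing p with
  | zero => simp [one_apply, Prod.ext_iff, ite_and]
  | succ t ih =>
    calc ∑ B, (visitMatrix P ^ (t + 1)) p (B, y)
        = (visitMatrix P *ᵥ fun q => ∑ B, (visitMatrix P ^ t) q (B, y)) p := by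
          simp only [pow_succ', mul_apply, mulVec, dotProduct, Finset.mul_sum]
          exact Finset.sum_comm
      _ = (P ^ (t + 1)) p.2 y := by
          simp only [ih, visitMatrix_mulVec, pow_succ' P, mul_apply]

/-- Condition on the state at time `N`: forgetting the visits before `N` only delays covering. -/
lemma sum_uncovered_add_le (hP : P ∈ rowStochastic ℝ S) {p : Finset S × S} (hp : p.2 ∈ p.1)
    (N : ℕ) {T : ℕ} {M : ℝ} (hM : ∀ x, ∑ t ∈ Finset.range T, uncovered P t ({x}, x) ≤ M) :
    ∑ t ∈ Finset.range T, uncovered P (N + t) p ≤ uncovered P N p * M := by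
  calc ∑ t ∈ Finset.range T, uncovered P (N + t) p
      = ∑ q, (visitMatrix P ^ N) p q * ∑ t ∈ Finset.range T, uncovered P t q := by
        simp only [uncovered_add, mulVec, dotProduct, Finset.mul_sum]
        exact Finset.sum_comm
    _ ≤ ∑ q, (visitMatrix P ^ N) p q * ((if q.1 = Finset.univ then 0 else 1) * M) := by
        refine Finset.sum_le_sum fun ⟨B, y⟩ _ => ?_
        by_cases hq : (visitMatrix P ^ N) p (B, y) = 0
        · rw [hq, zero_mul, zero_mul]
        · refine mul_le_mul_of_nonneg_left ?_
            ((pow_mem (visitMatrix_mem_rowStochastic hP) N).1 p (B, y))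
          split_ifs with hB
          · simp only [show B = Finset.univ from hB, uncovered_univ hP, Finset.sum_const_zero,
              zero_mul, le_rfl]
          · rw [one_mul]
            refine (Finset.sum_le_sum fun t _ => uncovered_anti_set hP t ?_ y).trans (hM y)
            exact Finset.singleton_subset_iff.2
              (insert_subset_of_visitMatrix_pow_ne_zero hp hq (Finset.mem_insert_self _ _))
    _ = uncovered P N p * M := by
        simp only [uncovered, mulVec, dotProduct, Finset.sum_mul, mul_assoc]

lemma sum_uncovered_le (hP : P ∈ rowStochastic ℝ S) {N : ℕ} {q : ℝ} (hq : q < 1)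
    (hN : ∀ x, uncovered P N ({x}, x) ≤ q) (T : ℕ) (x : S) :
    ∑ t ∈ Finset.range T, uncovered P t ({x}, x) ≤ N / (1 - q) := by
  have : Nonempty S := ⟨x⟩
  obtain ⟨z, hz⟩ := Finite.exists_max fun x => ∑ t ∈ Finset.range T, uncovered P t ({x}, x)
  refine (hz x).trans ?_
  set M := ∑ t ∈ Finset.range T, uncovered P t ({z}, z)
  have hM : 0 ≤ M := Finset.sum_nonneg fun t _ => uncovered_nonneg hP t _
  have hrenewal : M ≤ N + q * M := by
    calc M ≤ ∑ t ∈ Finset.range (N + T), uncovered P t ({z}, z) :=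
          Finset.sum_le_sum_of_subset_of_nonneg
            (Finset.range_subset_range.2 (Nat.le_add_left T N))
            fun t _ _ => uncovered_nonneg hP t _
      _ = ∑ t ∈ Finset.range N, uncovered P t ({z}, z) +
            ∑ t ∈ Finset.range T, uncovered P (N + t) ({z}, z) := Finset.sum_range_add _ N T
      _ ≤ N + uncovered P N ({z}, z) * M := by
          refine add_le_add ?_ (sum_uncovered_add_le hP (Finset.mem_singleton_self z) N hz)
          exact (Finset.sum_le_sum fun t _ => uncovered_le_one hP t _).trans_eq (by simp)
      _ ≤ N + q * M := by
          gcongr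
          exact hN z
  rw [le_div_iff₀ (by linarith)]
  linarith

lemma coverTime_le (hP : P ∈ rowStochastic ℝ S) {N : ℕ} {q : ℝ} (hq : q < 1)
    (hN : ∀ x, uncovered P N ({x}, x) ≤ q) : coverTime P hP ≤ ENNReal.ofReal (N / (1 - q)) := by
  rw [coverTime_eq_iSup_tsum]
  refine iSup_le fun x => ?_
  rw [ENNReal.tsum_eq_iSup_nat]
  refine iSup_le fun T => ?_
  rw [← ENNReal.ofReal_sum_of_nonneg fun t _ => uncovered_nonneg hP t _]
  exact ENNReal.ofReal_le_ofReal (sum_uncovered_le hP hq hN T x)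

lemma exists_uncovered_lt_one (hP : P ∈ rowStochastic ℝ S) (hirr : P.IsIrreducible) {A : Finset S}
    {x : S} (hx : x ∈ A) : ∃ t, uncovered P t (A, x) < 1 := by
  induction A using WellFoundedGT.induction generalizing x with
  | _ A ih =>
    obtain rfl | hA := eq_or_ne A Finset.univ
    · exact ⟨0, by simp [uncovered_zero]⟩
    obtain ⟨y, hy⟩ : ∃ y, y ∉ A := by
      simpa [Finset.eq_univ_iff_forall] using hA
    obtain ⟨s, -, hs⟩ := (isIrreducible_iff_exists_pow_pos hP.1).1 hirr x y
    obtain ⟨B, -, hB⟩ : ∃ B ∈ Finset.univ, 0 < (visitMatrix P ^ s) (A, x) (B, y) :=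
      Finset.exists_lt_of_sum_lt (by simpa [sum_visitMatrix_pow] using hs)
    have hsub : insert y A ⊆ B := insert_subset_of_visitMatrix_pow_ne_zero hx hB.ne'
    obtain ⟨t, ht⟩ := ih B ((Finset.ssubset_insert hy).trans_subset hsub)
      (hsub (Finset.mem_insert_self y A))
    have hV := pow_mem (visitMatrix_mem_rowStochastic hP) s
    refine ⟨s + t, ?_⟩
    rw [uncovered_add, ← sum_row_of_mem_rowStochastic hV (A, x)]
    exact Finset.sum_lt_sum
      (fun q _ => mul_le_of_le_one_right (hV.1 _ q) (uncovered_le_one hP t q))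
      ⟨(B, y), Finset.mem_univ _, mul_lt_of_lt_one_right hB ht⟩

lemma coverTime_ne_top [Nonempty S] (hP : P ∈ rowStochastic ℝ S) (hirr : P.IsIrreducible) :
    coverTime P hP ≠ ⊤ := by
  choose T hT using fun x => exists_uncovered_lt_one hP hirr (Finset.mem_singleton_self x)
  obtain ⟨z, hz⟩ := Finite.exists_max T
  obtain ⟨w, hw⟩ := Finite.exists_max fun x => uncovered P (T z) ({x}, x)
  have hlt : uncovered P (T z) ({w}, w) < 1 := (uncovered_antitone hP _ (hz w)).trans_lt (hT w)
  exact ne_top_of_le_ne_top ENNReal.ofReal_ne_top (coverTime_le hP hlt hw)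

lemma tsum_ofReal_uncovered_le_coverTime (hP : P ∈ rowStochastic ℝ S) (x : S) :
    ∑' t, ENNReal.ofReal (uncovered P t ({x}, x)) ≤ coverTime P hP := by
  rw [coverTime_eq_iSup_tsum]
  exact le_iSup (fun x => ∑' t, ENNReal.ofReal (uncovered P t ({x}, x))) x

lemma sum_uncovered_le_toReal_coverTime (hP : P ∈ rowStochastic ℝ S) (hfin : coverTime P hP ≠ ⊤)
    (x : S) (T : ℕ) :
    ∑ t ∈ Finset.range T, uncovered P t ({x}, x) ≤ (coverTime P hP).toReal := by
  have hnonneg : ∀ t, 0 ≤ uncovered P t ({x}, x) := fun t => uncovered_nonneg hP t _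
  rw [← ENNReal.toReal_ofReal (Finset.sum_nonneg fun t _ => hnonneg t),
    ENNReal.ofReal_sum_of_nonneg fun t _ => hnonneg t]
  exact ENNReal.toReal_mono hfin
    ((ENNReal.sum_le_tsum _).trans (tsum_ofReal_uncovered_le_coverTime hP x))

lemma succ_mul_uncovered_le_toReal_coverTime (hP : P ∈ rowStochastic ℝ S)
    (hfin : coverTime P hP ≠ ⊤) (t : ℕ) (x : S) :
    (t + 1) * uncovered P t ({x}, x) ≤ (coverTime P hP).toReal := by
  calc (t + 1) * uncovered P t ({x}, x)
      = ∑ _s ∈ Finset.range (t + 1), uncovered P t ({x}, x) := by simp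
    _ ≤ ∑ s ∈ Finset.range (t + 1), uncovered P s ({x}, x) := Finset.sum_le_sum fun s hs =>
        uncovered_antitone hP _ (Nat.lt_succ_iff.1 (Finset.mem_range.1 hs))
    _ ≤ (coverTime P hP).toReal := sum_uncovered_le_toReal_coverTime hP hfin x (t + 1)

lemma one_le_toReal_coverTime [Nontrivial S] (hP : P ∈ rowStochastic ℝ S)
    (hfin : coverTime P hP ≠ ⊤) : 1 ≤ (coverTime P hP).toReal := by
  obtain ⟨x⟩ : Nonempty S := inferInstance
  have h := succ_mul_uncovered_le_toReal_coverTime hP hfin 0 x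
  rwa [uncovered_zero, if_neg (Finset.singleton_ne_univ x), Nat.cast_zero, zero_add, mul_one] at h

end Covering

section HittingTimes

variable {S : Type*} [Fintype S] [DecidableEq S] {P : Matrix S S ℝ} {π : S → ℝ} {y : S}

/-- The probability that the chain started at `x` has not visited `y` by time `t`. -/
def unhit (P : Matrix S S ℝ) (y : S) : ℕ → S → ℝ
  | 0, x => if x = y then 0 else 1
  | t + 1, x => if x = y then 0 else (P *ᵥ unhit P y t) x

/-- The expected hitting time of `y` from `x`, as the sum of the tail probabilities. It has the junk
value `0` if this sum diverges. -/
def hittingTime (P : Matrix S S ℝ) (y x : S) : ℝ :=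
  ∑' t, unhit P y t x

lemma unhit_self (P : Matrix S S ℝ) (y : S) (t : ℕ) : unhit P y t y = 0 := by
  cases t <;> simp [unhit]

lemma hittingTime_self (P : Matrix S S ℝ) (y : S) : hittingTime P y y = 0 := by
  simp [hittingTime, unhit_self]

lemma unhit_nonneg (hP : P ∈ rowStochastic ℝ S) (y : S) (t : ℕ) (x : S) : 0 ≤ unhit P y t x := by
  induction t generalizing x with
  | zero =>
    rw [unhit]
    positivity
  | succ t ih =>
    rw [unhit]
    split_ifs
    exacts [le_rfl, nonneg_mulVec_of_mem_rowStochastic hP ih x]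

lemma unhit_le_uncovered_of_notMem (hP : P ∈ rowStochastic ℝ S) {A : Finset S} (hy : y ∉ A)
    (t : ℕ) (x : S) : unhit P y t x ≤ uncovered P t (A, x) := by
  induction t generalizing A x with
  | zero =>
    rw [unhit, uncovered_zero, if_neg (ne_of_mem_of_not_mem' (Finset.mem_univ y) hy).symm]
    split_ifs <;> norm_num
  | succ t ih =>
    rw [unhit]
    split_ifs with hx
    · exact uncovered_nonneg hP _ _
    · rw [uncovered_succ]
      refine Finset.sum_le_sum fun z _ => mul_le_mul_of_nonneg_left ?_ (hP.1 x z)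
      obtain rfl | hz := eq_or_ne z y
      · rw [unhit_self]
        exact uncovered_nonneg hP _ _
      · exact ih (by simp [hy, hz.symm]) z

lemma unhit_le_uncovered (hP : P ∈ rowStochastic ℝ S) (y : S) (t : ℕ) (x : S) :
    unhit P y t x ≤ uncovered P t ({x}, x) := by
  obtain rfl | hx := eq_or_ne x y
  · rw [unhit_self]
    exact uncovered_nonneg hP _ _
  · exact unhit_le_uncovered_of_notMem hP (by simpa using hx.symm) t x

lemma sum_unhit_le_toReal_coverTime (hP : P ∈ rowStochastic ℝ S) (hfin : coverTime P hP ≠ ⊤)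
    (y x : S) (T : ℕ) : ∑ t ∈ Finset.range T, unhit P y t x ≤ (coverTime P hP).toReal :=
  (Finset.sum_le_sum fun t _ => unhit_le_uncovered hP y t x).trans
    (sum_uncovered_le_toReal_coverTime hP hfin x T)

lemma summable_unhit (hP : P ∈ rowStochastic ℝ S) (hfin : coverTime P hP ≠ ⊤) (y x : S) :
    Summable fun t => unhit P y t x :=
  summable_of_sum_range_le (fun t => unhit_nonneg hP y t x)
    (sum_unhit_le_toReal_coverTime hP hfin y x)

lemma hittingTime_le_toReal_coverTime (hP : P ∈ rowStochastic ℝ S) (hfin : coverTime P hP ≠ ⊤)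
    (y x : S) : hittingTime P y x ≤ (coverTime P hP).toReal :=
  Real.tsum_le_of_sum_range_le (fun t => unhit_nonneg hP y t x)
    (sum_unhit_le_toReal_coverTime hP hfin y x)

lemma hittingTime_eq_one_add (hsum : ∀ x, Summable fun t => unhit P y t x) {x : S} (hx : x ≠ y) :
    hittingTime P y x = 1 + (P *ᵥ hittingTime P y) x := by
  have hsucc : ∀ t, unhit P y (t + 1) x = ∑ z, P x z * unhit P y t z := fun t => by
    rw [unhit, if_neg hx]
    rfl
  rw [hittingTime, (hsum x).tsum_eq_zero_add, unhit, if_neg hx, tsum_congr hsucc,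
    Summable.tsum_finsetSum fun z _ => (hsum z).mul_left (P x z)]
  simp_rw [tsum_mul_left]
  rfl

/-- Kac's formula: the expected return time to `y` is `(π y)⁻¹`. -/
lemma IsStationary.mul_one_add_mulVec_hittingTime (hπ : IsStationary P π)
    (hsum : ∀ x, Summable fun t => unhit P y t x) :
    π y * (1 + (P *ᵥ hittingTime P y) y) = 1 := by
  calc π y * (1 + (P *ᵥ hittingTime P y) y)
      = ∑ x, π x * (1 + (P *ᵥ hittingTime P y) x - hittingTime P y x) := by
        rw [Finset.sum_eq_single y (fun x _ hx => ?_) (by simp), hittingTime_self, sub_zero]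
        rw [hittingTime_eq_one_add hsum hx, sub_self, mul_zero]
    _ = 1 := by
        simp_rw [mul_sub, mul_add, Finset.sum_sub_distrib, Finset.sum_add_distrib,
          hπ.sum_mul_mulVec, mul_one, hπ.2.1, add_sub_cancel_right]

lemma IsStationary.sum_pow_apply_self (hP : P ∈ rowStochastic ℝ S) (hπ : IsStationary P π)
    (hsum : ∀ x, Summable fun t => unhit P y t x) (T : ℕ) :
    ∑ t ∈ Finset.range T, (P ^ t) y y = π y * (T + (P ^ T *ᵥ hittingTime P y) y) := by
  have hreturn : hittingTime P y = 1 + P *ᵥ hittingTime P y -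
      Pi.single y (1 + (P *ᵥ hittingTime P y) y) := by
    funext x
    obtain rfl | hx := eq_or_ne x y
    · simp [hittingTime_self]
    · simpa [hx] using hittingTime_eq_one_add hsum hx
  have hstep : ∀ t, (P ^ t *ᵥ hittingTime P y) y = 1 + (P ^ (t + 1) *ᵥ hittingTime P y) y -
      (P ^ t) y y * (1 + (P *ᵥ hittingTime P y) y) := fun t => by
    conv_lhs => rw [hreturn]
    rw [mulVec_sub, mulVec_add, (pow_mem hP t).2, mulVec_mulVec, ← pow_succ]
    simp
  induction T with
  | zero => simp [hittingTime_self]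
  | succ T ih =>
    rw [Finset.sum_range_succ, ih, hstep]
    push_cast
    linear_combination -(P ^ T) y y * hπ.mul_one_add_mulVec_hittingTime hsum

lemma IsReversible.mul_sq_sum_abs_sub_pow_le_toReal_coverTime (hP : P ∈ rowStochastic ℝ S)
    (hrev : IsReversible P π) (hpos : ∀ x, 0 < π x) (hlazy : ∀ x, 1 / 2 ≤ P x x)
    (hfin : coverTime P hP ≠ ⊤) (t : ℕ) (x : S) :
    2 * t * (∑ y, |π y - (P ^ t) x y|) ^ 2 ≤ (coverTime P hP).toReal := by
  have hdiag : (2 * t : ℝ) * (P ^ (t + t)) x x ≤ ∑ s ∈ Finset.range (t + t), (P ^ s) x x := by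
    simpa [two_mul] using Finset.card_nsmul_le_sum (Finset.range (t + t)) (fun s => (P ^ s) x x)
      ((P ^ (t + t)) x x) fun s hs =>
        hrev.antitone_pow_apply_self hP hlazy (hpos x) (Finset.mem_range.1 hs).le
  rw [(hrev.isStationary hP).sum_pow_apply_self hP (summable_unhit hP hfin x),
    ← div_le_iff₀' (hpos x), mul_div_assoc, Nat.cast_add] at hdiag
  have hhit := mulVec_le_of_forall_le (pow_mem hP (t + t))
    (hittingTime_le_toReal_coverTime hP hfin x) x
  calc 2 * t * (∑ y, |π y - (P ^ t) x y|) ^ 2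
      ≤ 2 * t * ((P ^ (t + t)) x x / π x - 1) := by
        gcongr
        exact hrev.sq_sum_abs_sub_pow_le hP hpos t x
    _ ≤ (coverTime P hP).toReal := by linarith

end HittingTimes

section Lamps

variable {S : Type*} [Fintype S] [DecidableEq S] {P : Matrix S S ℝ} {π : S → ℝ}

/-- Transition matrix on lamp configurations that sets the lamps in `A` to independent uniform
values and keeps the other ones. -/
def lampRefresh (A : Finset S) : Matrix (S → ZMod 2) (S → ZMod 2) ℝ :=
  fun f g => ∏ v, if v ∈ A then 1 / 2 else if f v = g v then 1 else 0

lemma lampRefresh_apply (A : Finset S) (f g : S → ZMod 2) :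
    lampRefresh A f g = if ∀ v ∉ A, f v = g v then (2 ^ A.card)⁻¹ else 0 := by
  calc lampRefresh A f g
      = ∏ v, if v ∉ A → f v = g v then if v ∈ A then (2 : ℝ)⁻¹ else 1 else 0 :=
        Finset.prod_congr rfl fun v _ => by
          by_cases hv : v ∈ A <;> simp [hv]
    _ = if ∀ v ∉ A, f v = g v then (2 ^ A.card)⁻¹ else 0 := by
        rw [Finset.prod_ite_zero]
        simp [Finset.prod_ite_mem]

lemma lampRefresh_comm (A : Finset S) (f g : S → ZMod 2) :
    lampRefresh A f g = lampRefresh A g f := by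
  simp only [lampRefresh, eq_comm]

lemma lampRefresh_univ (f g : S → ZMod 2) :
    lampRefresh Finset.univ f g = (2 ^ Fintype.card S)⁻¹ := by
  simp [lampRefresh_apply]

lemma lampRefresh_singleton (x : S) (f g : S → ZMod 2) :
    lampRefresh {x} f g = ∑ a, if g = Function.update f x a then 1 / 2 else 0 := by
  simp [lampRefresh_apply, Function.eq_update_iff, ite_and, eq_comm]

lemma lampRefresh_mul (A B : Finset S) : lampRefresh A * lampRefresh B = lampRefresh (A ∪ B) := by
  ext f g
  rw [mul_apply]
  simp only [lampRefresh, ← Finset.prod_mul_distrib]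
  rw [← Fintype.piFinset_univ, ← Finset.prod_univ_sum (fun _ => Finset.univ) fun v c =>
    (if v ∈ A then 1 / 2 else if f v = c then 1 else 0) *
      (if v ∈ B then 1 / 2 else if c = g v then 1 else (0 : ℝ))]
  refine Finset.prod_congr rfl fun v _ => ?_
  by_cases hA : v ∈ A <;> by_cases hB : v ∈ B <;> simp [hA, hB, ZMod.card]

lemma lampRefresh_mem_rowStochastic (A : Finset S) :
    lampRefresh A ∈ rowStochastic ℝ (S → ZMod 2) := by
  rw [mem_rowStochastic_iff_sum]
  refine ⟨fun f g => Finset.prod_nonneg fun v _ => by positivity, fun f => ?_⟩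
  simp only [lampRefresh]
  rw [← Fintype.piFinset_univ, ← Finset.prod_univ_sum (fun _ => Finset.univ) fun v c =>
    if v ∈ A then 1 / 2 else if f v = c then 1 else (0 : ℝ)]
  refine Finset.prod_eq_one fun v _ => ?_
  by_cases hv : v ∈ A <;> simp [hv, ZMod.card]

lemma lampMatrix_apply (P : Matrix S S ℝ) (f g : S → ZMod 2) (x y : S) :
    lampMatrix P (f, x) (g, y) = P x y * lampRefresh {x, y} f g := by
  have hrefresh : lampRefresh {x, y} f g =
      ∑ a, 1 / 2 * lampRefresh {y} (Function.update f x a) g := by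
    rw [← Finset.singleton_union, ← lampRefresh_mul, mul_apply]
    simp_rw [lampRefresh_singleton x, Finset.sum_mul]
    rw [Finset.sum_comm]
    simp only [ite_mul, zero_mul, Finset.sum_ite_eq', Finset.mem_univ, if_true]
  rw [hrefresh, lampMatrix]
  simp_rw [lampRefresh_singleton, Finset.mul_sum]
  norm_num

lemma lampMatrix_mem_rowStochastic (hP : P ∈ rowStochastic ℝ S) :
    lampMatrix P ∈ rowStochastic ℝ ((S → ZMod 2) × S) := by
  rw [mem_rowStochastic_iff_sum]
  refine ⟨fun ⟨f, x⟩ ⟨g, y⟩ => ?_, fun ⟨f, x⟩ => ?_⟩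
  · rw [lampMatrix_apply]
    exact mul_nonneg (hP.1 x y) ((lampRefresh_mem_rowStochastic _).1 f g)
  · simp_rw [Fintype.sum_prod_type_right, lampMatrix_apply, ← Finset.mul_sum,
      sum_row_of_mem_rowStochastic (lampRefresh_mem_rowStochastic _), mul_one,
      sum_row_of_mem_rowStochastic hP]

lemma IsReversible.lamplighter (hrev : IsReversible P π) :
    IsReversible (lampMatrix P) (lampDist π) := by
  refine ⟨fun p => mul_nonneg (hrev.nonneg p.2) (by positivity), ?_, fun ⟨f, x⟩ ⟨g, y⟩ => ?_⟩
  · simp [lampDist, Fintype.sum_prod_type, ← Finset.sum_mul, hrev.sum_eq_one, ZMod.card]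
  · rw [lampMatrix_apply, lampMatrix_apply, lampRefresh_comm, Finset.pair_comm]
    simp only [lampDist]
    linear_combination (2 ^ Fintype.card S)⁻¹ * lampRefresh {y, x} g f * hrev.balance x y

omit [DecidableEq S] in
lemma lampDist_pos (hpos : ∀ x, 0 < π x) (p : (S → ZMod 2) × S) : 0 < lampDist π p :=
  mul_pos (hpos p.2) (by positivity)

/-- After at least one step, and given the positions, the lamps at the visited states are
independent and uniform while the other ones are unchanged. -/
lemma lampMatrix_pow_succ (P : Matrix S S ℝ) (t : ℕ) (f g : S → ZMod 2) (x y : S) :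
    (lampMatrix P ^ (t + 1)) (f, x) (g, y) =
      ∑ A, (visitMatrix P ^ (t + 1)) ({x}, x) (A, y) * lampRefresh A f g := by
  induction t generalizing g y with
  | zero =>
    rw [zero_add, pow_one, pow_one, lampMatrix_apply]
    simp [visitMatrix, Finset.pair_comm]
  | succ t ih =>
    have hrefresh : ∀ A z, (visitMatrix P ^ (t + 1)) ({x}, x) (A, z) *
        ∑ h, lampRefresh A f h * lampRefresh {z, y} h g =
          (visitMatrix P ^ (t + 1)) ({x}, x) (A, z) * lampRefresh (insert y A) f g := by
      intro A z
      by_cases h : (visitMatrix P ^ (t + 1)) ({x}, x) (A, z) = 0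
      · rw [h, zero_mul, zero_mul]
      · have hz : z ∈ A := insert_subset_of_visitMatrix_pow_ne_zero (Finset.mem_singleton_self x) h
          (Finset.mem_insert_self _ _)
        have hunion : A ∪ {z, y} = insert y A := by grind
        rw [← mul_apply, lampRefresh_mul, hunion]
    calc (lampMatrix P ^ (t + 1 + 1)) (f, x) (g, y)
        = ∑ z, ∑ h, (lampMatrix P ^ (t + 1)) (f, x) (h, z) * lampMatrix P (h, z) (g, y) := by
          rw [pow_succ, mul_apply, Fintype.sum_prod_type_right]
      _ = ∑ z, ∑ A, P z y * ((visitMatrix P ^ (t + 1)) ({x}, x) (A, z) *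
            ∑ h, lampRefresh A f h * lampRefresh {z, y} h g) := by
          refine Finset.sum_congr rfl fun z _ => ?_
          simp only [ih, lampMatrix_apply, Finset.sum_mul, Finset.mul_sum]
          rw [Finset.sum_comm]
          refine Finset.sum_congr rfl fun A _ => Finset.sum_congr rfl fun h _ => ?_
          ring
      _ = ∑ A, (visitMatrix P ^ (t + 1 + 1)) ({x}, x) (A, y) * lampRefresh A f g := by
          simp_rw [hrefresh, pow_succ _ (t + 1), mul_apply, Finset.sum_mul]
          rw [Finset.sum_comm (s := Finset.univ (α := Finset S)), Fintype.sum_prod_type_right]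
          refine Finset.sum_congr rfl fun z _ => Finset.sum_congr rfl fun A _ => ?_
          simp only [visitMatrix, mul_ite, mul_zero, ite_mul, zero_mul, Finset.sum_ite_eq',
            Finset.mem_univ, if_true]
          ring

lemma le_lampMatrix_pow_succ (hP : P ∈ rowStochastic ℝ S) (t : ℕ) (f g : S → ZMod 2) (x y : S) :
    (visitMatrix P ^ (t + 1)) ({x}, x) (Finset.univ, y) * (2 ^ Fintype.card S)⁻¹ ≤
      (lampMatrix P ^ (t + 1)) (f, x) (g, y) := by
  rw [lampMatrix_pow_succ, ← lampRefresh_univ f g]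
  exact Finset.single_le_sum
    (f := fun A => (visitMatrix P ^ (t + 1)) ({x}, x) (A, y) * lampRefresh A f g)
    (fun A _ => mul_nonneg ((pow_mem (visitMatrix_mem_rowStochastic hP) _).1 _ _)
      ((lampRefresh_mem_rowStochastic A).1 f g)) (Finset.mem_univ _)

lemma lampMatrix_pow_succ_zero_one (P : Matrix S S ℝ) (t : ℕ) (x y : S) :
    (lampMatrix P ^ (t + 1)) (0, x) (1, y) =
      (visitMatrix P ^ (t + 1)) ({x}, x) (Finset.univ, y) * (2 ^ Fintype.card S)⁻¹ := by
  rw [lampMatrix_pow_succ, Finset.sum_eq_single Finset.univ (fun A _ hA => ?_) (by simp),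
    lampRefresh_univ]
  obtain ⟨v, hv⟩ : ∃ v, v ∉ A := by
    simpa [Finset.eq_univ_iff_forall] using hA
  rw [lampRefresh_apply, if_neg fun h => zero_ne_one (h v hv), mul_zero]

lemma sum_pow_sub_visitMatrix_pow (P : Matrix S S ℝ) (t : ℕ) (p : Finset S × S) :
    ∑ y, ((P ^ t) p.2 y - (visitMatrix P ^ t) p (Finset.univ, y)) = uncovered P t p := by
  rw [uncovered, mulVec, dotProduct, Fintype.sum_prod_type_right]
  refine Finset.sum_congr rfl fun y _ => ?_
  rw [← sum_visitMatrix_pow, ← Finset.sum_erase_eq_sub (Finset.mem_univ Finset.univ),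
    ← Finset.sum_erase Finset.univ (a := Finset.univ) (by simp)]
  refine Finset.sum_congr rfl fun A hA => ?_
  rw [if_neg (Finset.ne_of_mem_erase hA), mul_one]

end Lamps

section TotalVariation

variable {S : Type*} [Fintype S]

lemma tvDist_le_sum_of_sub_le {μ ν d : S → ℝ} (hsum : ∑ a, μ a = ∑ a, ν a) (hd : ∀ a, 0 ≤ d a)
    (hsub : ∀ a, ν a - μ a ≤ d a) : tvDist μ ν ≤ ∑ a, d a := by
  classical
  have hdiff : ∀ A : Finset S, ∑ a ∈ A, ν a - ∑ a ∈ A, μ a ≤ ∑ a, d a := fun A => by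
    rw [← Finset.sum_sub_distrib]
    exact (Finset.sum_le_sum fun a _ => hsub a).trans (Finset.sum_le_univ_sum_of_nonneg hd)
  refine ciSup_le fun A => abs_sub_le_iff.2 ⟨?_, hdiff A⟩
  linarith [hdiff Aᶜ, Finset.sum_add_sum_compl A μ, Finset.sum_add_sum_compl A ν]

omit [Fintype S] in
lemma abs_sum_sub_sum_le_tvDist [Finite S] (μ ν : S → ℝ) (A : Finset S) :
    |∑ a ∈ A, μ a - ∑ a ∈ A, ν a| ≤ tvDist μ ν :=
  le_ciSup (f := fun A : Finset S => |∑ a ∈ A, μ a - ∑ a ∈ A, ν a|) (Set.finite_range _).bddAbove A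

lemma one_sub_tvDist_sub_tvDist_le_sum_min (μ ν : S → ℝ) {π : S → ℝ} (hπ : ∑ a, π a = 1) :
    1 - tvDist μ π - tvDist ν π ≤ ∑ a, min (μ a) (ν a) := by
  classical
  set A : Finset S := {a | μ a ≤ ν a} with hA
  have hμ := (abs_le.1 (abs_sum_sub_sum_le_tvDist μ π A)).1
  have hν := (abs_le.1 (abs_sum_sub_sum_le_tvDist ν π Aᶜ)).1
  have hmin : ∑ a, min (μ a) (ν a) = ∑ a ∈ A, μ a + ∑ a ∈ Aᶜ, ν a := by
    simp_rw [min_def, Finset.sum_ite, hA, Finset.compl_filter]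
  rw [← Finset.sum_add_sum_compl A] at hπ
  linarith

variable [DecidableEq S] {M : Matrix S S ℝ} {π : S → ℝ} {ε : ℝ}

lemma tvDist_le_mixDist (M : Matrix S S ℝ) (π : S → ℝ) (t : ℕ) (x : S) :
    tvDist ((M ^ t) x) π ≤ mixDist M π t :=
  le_ciSup (f := fun x => tvDist ((M ^ t) x) π) (Set.finite_range _).bddAbove x

lemma mixingTime_le {t : ℕ} (ht : mixDist M π t ≤ ε) : mixingTime M π ε ≤ t :=
  iInf₂_le t ht

lemma le_mixingTime {a : ℝ≥0∞} (ha : ∀ t : ℕ, mixDist M π t ≤ ε → a ≤ t) :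
    a ≤ (mixingTime M π ε : ℝ≥0∞) := by
  simpa [mixingTime, ENat.toENNReal_iInf] using ha

lemma IsReversible.div_four_le_pow_add_self (hM : M ∈ rowStochastic ℝ S)
    (hrev : IsReversible M π) (hpos : ∀ x, 0 < π x) {t : ℕ} (ht : mixDist M π t ≤ 1 / 4) (x y : S) :
    π y / 4 ≤ (M ^ (t + t)) x y := by
  have hoverlap : 1 / 2 ≤ ∑ z, min ((M ^ t) x z) ((M ^ t) y z) := by
    linarith [one_sub_tvDist_sub_tvDist_le_sum_min ((M ^ t) x) ((M ^ t) y) hrev.sum_eq_one,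
      tvDist_le_mixDist M π t x, tvDist_le_mixDist M π t y]
  calc π y / 4 = π y * (1 / 2) ^ 2 := by ring
    _ ≤ π y * (∑ z, min ((M ^ t) x z) ((M ^ t) y z)) ^ 2 := by
        gcongr
        exact hrev.nonneg y
    _ ≤ (M ^ (t + t)) x y := hrev.mul_sq_sum_min_le hM hpos t x y

end TotalVariation

section LampMixing

variable {S : Type*} [Fintype S] [DecidableEq S] {P : Matrix S S ℝ} {π : S → ℝ}

lemma visitMatrix_pow_le (hP : P ∈ rowStochastic ℝ S) (t : ℕ) (p q : Finset S × S) :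
    (visitMatrix P ^ t) p q ≤ (P ^ t) p.2 q.2 := by
  rw [← sum_visitMatrix_pow]
  exact Finset.single_le_sum (f := fun B => (visitMatrix P ^ t) p (B, q.2))
    (fun B _ => (pow_mem (visitMatrix_mem_rowStochastic hP) t).1 _ _) (Finset.mem_univ q.1)

lemma IsReversible.tvDist_lampMatrix_pow_succ_le (hP : P ∈ rowStochastic ℝ S)
    (hrev : IsReversible P π) (t : ℕ) (f : S → ZMod 2) (x : S) :
    tvDist ((lampMatrix P ^ (t + 1)) (f, x)) (lampDist π) ≤
      uncovered P (t + 1) ({x}, x) + ∑ y, |π y - (P ^ (t + 1)) x y| := by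
  set r : S → ℝ := fun y => (visitMatrix P ^ (t + 1)) ({x}, x) (Finset.univ, y)
  have hrP : ∀ y, 0 ≤ (P ^ (t + 1)) x y - r y := fun y =>
    sub_nonneg.2 (visitMatrix_pow_le hP (t + 1) ({x}, x) (Finset.univ, y))
  set d : (S → ZMod 2) × S → ℝ := fun q =>
    ((P ^ (t + 1)) x q.2 - r q.2 + |π q.2 - (P ^ (t + 1)) x q.2|) * (2 ^ Fintype.card S)⁻¹ with hd
  have hsub : ∀ q, lampDist π q - (lampMatrix P ^ (t + 1)) (f, x) q ≤ d q := fun ⟨g, y⟩ =>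
    calc lampDist π (g, y) - (lampMatrix P ^ (t + 1)) (f, x) (g, y)
        ≤ π y * (2 ^ Fintype.card S)⁻¹ - r y * (2 ^ Fintype.card S)⁻¹ :=
          sub_le_sub_left (le_lampMatrix_pow_succ hP t f g x y) _
      _ = ((P ^ (t + 1)) x y - r y + (π y - (P ^ (t + 1)) x y)) * (2 ^ Fintype.card S)⁻¹ := by ring
      _ ≤ d (g, y) := by
          exact mul_le_mul_of_nonneg_right (by gcongr; exact le_abs_self _) (by positivity)
  have hmass : ∑ q, (lampMatrix P ^ (t + 1)) (f, x) q = ∑ q, lampDist π q := by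
    rw [sum_row_of_mem_rowStochastic (pow_mem (lampMatrix_mem_rowStochastic hP) _),
      hrev.lamplighter.sum_eq_one]
  calc tvDist ((lampMatrix P ^ (t + 1)) (f, x)) (lampDist π)
      ≤ ∑ q, d q := tvDist_le_sum_of_sub_le hmass
        (fun q => mul_nonneg (add_nonneg (hrP q.2) (abs_nonneg _)) (by positivity)) hsub
    _ = ∑ y, ((P ^ (t + 1)) x y - r y) + ∑ y, |π y - (P ^ (t + 1)) x y| := by
        rw [Fintype.sum_prod_type_right, ← Finset.sum_add_distrib]
        simp [hd, ZMod.card, mul_comm]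
    _ = uncovered P (t + 1) ({x}, x) + ∑ y, |π y - (P ^ (t + 1)) x y| := by
        rw [← sum_pow_sub_visitMatrix_pow]

lemma IsReversible.mixDist_lampMatrix_le_quarter [Nontrivial S] (hP : P ∈ rowStochastic ℝ S)
    (hrev : IsReversible P π) (hpos : ∀ x, 0 < π x) (hlazy : ∀ x, 1 / 2 ≤ P x x)
    (hfin : coverTime P hP ≠ ⊤) {t : ℕ} (ht : 18 * (coverTime P hP).toReal < t + 1) :
    mixDist (lampMatrix P) (lampDist π) t ≤ 1 / 4 := by
  have hC := one_le_toReal_coverTime hP hfin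
  obtain ⟨s, rfl⟩ : ∃ s, t = s + 1 := Nat.exists_eq_succ_of_ne_zero fun h => by
    rw [h, Nat.cast_zero] at ht
    linarith
  refine ciSup_le fun ⟨f, x⟩ => (hrev.tvDist_lampMatrix_pow_succ_le hP s f x).trans ?_
  have hu := succ_mul_uncovered_le_toReal_coverTime hP hfin (s + 1) x
  have hw := hrev.mul_sq_sum_abs_sub_pow_le_toReal_coverTime hP hpos hlazy hfin (s + 1) x
  set T : ℝ := ((s + 1 : ℕ) : ℝ)
  set u := uncovered P (s + 1) ({x}, x)
  set w := ∑ y, |π y - (P ^ (s + 1)) x y|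
  have hu_le : u ≤ 1 / 18 := by
    by_contra! hlt
    nlinarith
  have hw_le : w ≤ 7 / 36 := by
    by_contra! hlt
    have : (7 / 36) ^ 2 < w ^ 2 := by gcongr
    nlinarith
  linarith

lemma IsReversible.uncovered_add_self_le (hP : P ∈ rowStochastic ℝ S) (hrev : IsReversible P π)
    (hpos : ∀ x, 0 < π x) {t : ℕ} (ht : mixDist (lampMatrix P) (lampDist π) t ≤ 1 / 4) (x : S) :
    uncovered P (t + t) ({x}, x) ≤ 3 / 4 := by
  have hlamp : ∀ y, π y * (2 ^ Fintype.card S)⁻¹ / 4 ≤ (lampMatrix P ^ (t + t)) (0, x) (1, y) :=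
    fun y => hrev.lamplighter.div_four_le_pow_add_self (lampMatrix_mem_rowStochastic hP)
      (lampDist_pos hpos) ht (0, x) (1, y)
  have hvisit : ∀ y, π y / 4 ≤ (visitMatrix P ^ (t + t)) ({x}, x) (Finset.univ, y) := by
    intro y
    have hy := hlamp y
    rcases hT : t + t with _ | T
    · have hne : ((0 : S → ZMod 2), x) ≠ (1, y) := fun h =>
        zero_ne_one (congrFun (congrArg Prod.fst h) x)
      rw [hT, pow_zero, one_apply_ne hne] at hy
      exact absurd hy (not_le.2 (by have := hpos y; positivity))
    · rw [hT, lampMatrix_pow_succ_zero_one, mul_div_right_comm] at hy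
      exact le_of_mul_le_mul_right hy (by positivity)
  calc uncovered P (t + t) ({x}, x)
      = 1 - ∑ y, (visitMatrix P ^ (t + t)) ({x}, x) (Finset.univ, y) := by
        rw [← sum_pow_sub_visitMatrix_pow, Finset.sum_sub_distrib,
          sum_row_of_mem_rowStochastic (pow_mem hP _)]
    _ ≤ 1 - ∑ y, π y / 4 := sub_le_sub_left (Finset.sum_le_sum fun y _ => hvisit y) 1
    _ = 3 / 4 := by
        rw [← Finset.sum_div, hrev.sum_eq_one]
        norm_num

lemma IsReversible.mixingTime_lampMatrix_le [Nontrivial S] (hP : P ∈ rowStochastic ℝ S)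
    (hrev : IsReversible P π) (hpos : ∀ x, 0 < π x) (hlazy : ∀ x, 1 / 2 ≤ P x x)
    (hfin : coverTime P hP ≠ ⊤) :
    (mixingTime (lampMatrix P) (lampDist π) (1 / 4) : ℝ≥0∞) ≤ 18 * coverTime P hP := by
  set t := ⌊18 * (coverTime P hP).toReal⌋₊
  have hmix := hrev.mixDist_lampMatrix_le_quarter hP hpos hlazy hfin (Nat.lt_floor_add_one _)
  calc (mixingTime (lampMatrix P) (lampDist π) (1 / 4) : ℝ≥0∞)
      ≤ ((t : ℕ∞) : ℝ≥0∞) := ENat.toENNReal_le.2 (mixingTime_le hmix)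
    _ = ENNReal.ofReal t := by simp
    _ ≤ ENNReal.ofReal (18 * (coverTime P hP).toReal) :=
        ENNReal.ofReal_le_ofReal (Nat.floor_le (by positivity))
    _ = 18 * coverTime P hP := by
        rw [ENNReal.ofReal_mul (by norm_num), ENNReal.ofReal_toReal hfin, ENNReal.ofReal_ofNat]

lemma IsReversible.le_mixingTime_lampMatrix (hP : P ∈ rowStochastic ℝ S)
    (hrev : IsReversible P π) (hpos : ∀ x, 0 < π x) :
    1 / 8 * coverTime P hP ≤ (mixingTime (lampMatrix P) (lampDist π) (1 / 4) : ℝ≥0∞) := by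
  refine le_mixingTime fun t ht => ?_
  have hcov : coverTime P hP ≤ 8 * t :=
    calc coverTime P hP ≤ ENNReal.ofReal ((t + t : ℕ) / (1 - 3 / 4)) :=
          coverTime_le hP (by norm_num) (hrev.uncovered_add_self_le hP hpos ht)
      _ = ENNReal.ofReal (8 * t) := by
          congr 1
          push_cast
          ring
      _ = 8 * t := by
          rw [ENNReal.ofReal_mul (by norm_num), ENNReal.ofReal_ofNat, ENNReal.ofReal_natCast]
  rw [one_div, mul_comm, ← div_eq_mul_inv]
  exact ENNReal.div_le_of_le_mul' hcov

end LampMixing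

section Graph

variable {V : Type*} [Fintype V] [DecidableEq V] [Nontrivial V] {G : SimpleGraph V}
  [DecidableRel G.Adj]

lemma isReversible_lazyWalk (hconn : G.Connected) :
    IsReversible (lazyWalk G) (degreeDist G) := by
  have hdeg : ∀ x, (0 : ℝ) < G.degree x := fun x =>
    Nat.cast_pos.2 (hconn.preconnected.degree_pos_of_nontrivial x)
  have hvol : 0 < ∑ v, (G.degree v : ℝ) :=
    Finset.sum_pos (fun v _ => hdeg v) Finset.univ_nonempty
  refine ⟨fun x => by rw [degreeDist]; positivity, ?_, fun x y => ?_⟩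
  · simp_rw [degreeDist]
    rw [← Finset.sum_div, div_self hvol.ne']
  · have := (hdeg x).ne'
    have := (hdeg y).ne'
    simp only [lazyWalk, degreeDist, G.adj_comm y x, eq_comm (a := y)]
    split_ifs with hxy hadj
    · rw [hxy]
    · field_simp
    · simp

lemma pow_length_succ_lazyWalk_pos (hconn : G.Connected) {x y : V} (w : G.Walk x y) :
    0 < (lazyWalk G ^ (w.length + 1)) x y := by
  induction w with
  | nil => simp [lazyWalk]
  | @cons x z y hadj w ih =>
    have hdeg : (0 : ℝ) < G.degree x :=
      Nat.cast_pos.2 (hconn.preconnected.degree_pos_of_nontrivial x)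
    have hstep : 0 < lazyWalk G x z := by
      rw [lazyWalk, if_neg hadj.ne, if_pos hadj]
      positivity
    rw [SimpleGraph.Walk.length_cons, pow_succ', mul_apply]
    exact (mul_pos hstep ih).trans_le (Finset.single_le_sum
      (f := fun z => lazyWalk G x z * (lazyWalk G ^ (w.length + 1)) z y)
      (fun z _ => mul_nonneg ((lazyWalk_mem hconn).1 x z)
        ((pow_mem (lazyWalk_mem hconn) _).1 z y)) (Finset.mem_univ z))

lemma isIrreducible_lazyWalk (hconn : G.Connected) : (lazyWalk G).IsIrreducible := by
  refine (isIrreducible_iff_exists_pow_pos (lazyWalk_mem hconn).1).2 fun x y => ?_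
  obtain ⟨w⟩ := hconn x y
  exact ⟨w.length + 1, w.length.succ_pos, pow_length_succ_lazyWalk_pos hconn w⟩

end Graph

end Lamplighter

end

theorem mainTheorem1_general {S : Type*} [Fintype S] [DecidableEq S] [Nontrivial S]
    {P : Matrix S S ℝ} (hP : P ∈ Matrix.rowStochastic ℝ S) {π : S → ℝ}
    (hrev : Lamplighter.IsReversible P π) (hlazy : ∀ x, 1 / 2 ≤ P x x) (hirr : P.IsIrreducible) :
    Lamplighter.coverTime P hP ≠ ⊤ ∧
    Lamplighter.IsStationary (Lamplighter.lampMatrix P) (Lamplighter.lampDist π) ∧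
    (1 / 8 : ℝ≥0∞) * Lamplighter.coverTime P hP ≤
      (Lamplighter.mixingTime (Lamplighter.lampMatrix P) (Lamplighter.lampDist π) (1 / 4) : ℝ≥0∞) ∧
    (Lamplighter.mixingTime (Lamplighter.lampMatrix P) (Lamplighter.lampDist π) (1 / 4) : ℝ≥0∞) ≤
      18 * Lamplighter.coverTime P hP := by
  have hfin := Lamplighter.coverTime_ne_top hP hirr
  have hpos := (hrev.isStationary hP).pos_of_isIrreducible hirr
  exact ⟨hfin, hrev.lamplighter.isStationary (Lamplighter.lampMatrix_mem_rowStochastic hP),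
    hrev.le_mixingTime_lampMatrix hP hpos, hrev.mixingTime_lampMatrix_le hP hpos hlazy hfin⟩

theorem mainTheorem1 {V : Type*} [Fintype V] [DecidableEq V] [Nontrivial V]
    (G : SimpleGraph V) [DecidableRel G.Adj] (hconn : G.Connected)
    (k : ℕ) (hreg : G.IsRegularOfDegree k) :
    Lamplighter.coverTime (Lamplighter.lazyWalk G) (Lamplighter.lazyWalk_mem hconn) ≠ ⊤ ∧
    Lamplighter.IsStationary (Lamplighter.lampMatrix (Lamplighter.lazyWalk G))
      (Lamplighter.lampDist (Lamplighter.degreeDist G)) ∧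
    (1 / 12 : ℝ≥0∞) *
        Lamplighter.coverTime (Lamplighter.lazyWalk G) (Lamplighter.lazyWalk_mem hconn) ≤
      (Lamplighter.mixingTime (Lamplighter.lampMatrix (Lamplighter.lazyWalk G))
        (Lamplighter.lampDist (Lamplighter.degreeDist G)) (1 / 4) : ℝ≥0∞) ∧
    (Lamplighter.mixingTime (Lamplighter.lampMatrix (Lamplighter.lazyWalk G))
        (Lamplighter.lampDist (Lamplighter.degreeDist G)) (1 / 4) : ℝ≥0∞) ≤
      18 * Lamplighter.coverTime (Lamplighter.lazyWalk G) (Lamplighter.lazyWalk_mem hconn) := by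
  obtain ⟨hfin, hstat, hle, hge⟩ := mainTheorem1_general (Lamplighter.lazyWalk_mem hconn)
    (Lamplighter.isReversible_lazyWalk hconn) (fun x => by simp [Lamplighter.lazyWalk])
    (Lamplighter.isIrreducible_lazyWalk hconn)
  exact ⟨hfin, hstat, (mul_le_mul_left (ENNReal.div_le_div_left (by norm_num) 1) _).trans hle, hge⟩
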